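/- Let $f$ be an entire function of order strictly less than $1$ such that, for some integer $\mu\ge 0$ and real numbers $a_n$, $$h(z):=z^{-\mu}f(z)=\sum_{n=0}^{\infty}a_nz^n,\qquad a_0a_n>0\quad\text{for all } n\ge 1,$$ where $h$ is extended to $z=0$ by $h(0)=a_0$. Suppose that there is $\beta_0\in(0,1)$ such that every nonzero root $-\lambda$ of $f$ satisfies $$\operatorname{Re}\lambda\ge\beta_0|\lambda|,$$ and that the infimum $\gamma_0$ of $\operatorname{Re}\lambda$ over all nonzero roots $-\lambda$ of $f$ satisfies $\gamma_0>1$. Define $$m_k=\frac{(-1)^{k+1}}{(k+1)!}\left(\frac{h'}{h}\right)^{(k+1)}(0),\qquad k=0,1,2,\dots,$$ and suppose that $$(-1)^k\Delta^km_n\ge 0\qquad\text{for all integers } n,k\ge 0,$$ where $\Delta m_n=m_{n+1}-m_n$. Then every zero of $f$ is a negative real number, except for the zero at the origin when $\mu\ge 1$. -/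

import Mathlib

open Filter Asymptotics
open scoped ComplexOrder ENNReal NNReal

/-- The order (of growth) of an entire function `f`: the infimum, in `[0, ∞]`, of all `ρ ≥ 0`
with `f(z) = O(exp(|z|^ρ))` as `|z| → ∞`. -/
noncomputable def entireOrder (f : ℂ → ℂ) : ℝ≥0∞ :=
  ⨅ (ρ : ℝ≥0) (_ : f =O[Bornology.cobounded ℂ] fun z : ℂ => Real.exp (‖z‖ ^ (ρ : ℝ))), (ρ : ℝ≥0∞)

/-- The set of all `w = -z`, where `z` runs through the nonzero roots of `f`. -/
def negNonzeroRoots (f : ℂ → ℂ) : Set ℂ := {w | w ≠ 0 ∧ f (-w) = 0}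

/-- The moments `m_k = (-1)^(k+1) / (k+1)! * (h'/h)^(k+1)(0)` of a function `h` that is analytic
and nonzero at the origin. -/
noncomputable def logDerivMoment (h : ℂ → ℂ) (k : ℕ) : ℂ :=
  (-1) ^ (k + 1) / ((k + 1).factorial : ℂ) * iteratedDeriv (k + 1) (logDeriv h) 0

open Finset fwdDiff_aux

/-! A completely monotone sequence is a Hausdorff moment sequence: `m k = L (t ^ k)` for a bounded
functional `L` on `C[0, 1]`, a weak-* limit of Bernstein sums. So `∑ (-w) ^ k * m k` continues to `G
w = L (1 / (1 + w t))`, analytic off `(-∞, -1]`. Taylor expansion at `0` gives `h' / h = c - w * G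
w`, where `c = (h' / h)(0)`, hence `h' = h * (c - w * G w)` on the whole slit domain by the identity
theorem. At a zero of `h` the quotient `h' / h` would have a pole, so all zeros of `h` lie on `(-∞,
-1]`. -/

/-! ### The Hausdorff moment problem via Bernstein weights -/

/-- Binomial theorem for `1 = (S - Δ) ^ r`, where the shift `S = Δ + 1` commutes with `Δ`. -/
theorem eq_sum_choose_mul_fwdDiff_iter (m : ℕ → ℂ) (k r : ℕ) :
    m k = ∑ i ∈ range (r + 1),
      (r.choose i : ℂ) * ((-1) ^ (r - i) * (fwdDiff 1)^[r - i] m (k + i)) := by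
  have hS : (shiftₗ ℕ ℂ 1) + (-fwdDiffₗ ℕ ℂ 1) = 1 := by simp [shiftₗ]
  have hc : Commute (shiftₗ ℕ ℂ 1) (-fwdDiffₗ ℕ ℂ 1) :=
    ((Commute.refl _).add_left (Commute.one_left _)).neg_right
  have h := congr_fun (LinearMap.congr_fun (hc.add_pow r) m) k
  rw [hS, one_pow, Module.End.one_apply] at h
  rw [h, LinearMap.sum_apply, Finset.sum_apply]
  refine sum_congr rfl fun i _ => ?_
  rw [← nsmul_eq_mul', neg_pow, LinearMap.smul_apply, Pi.smul_apply, Module.End.mul_apply,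
    shiftₗ_pow_apply, nsmul_eq_mul, ← coe_fwdDiffₗ_pow]
  congr 1
  rcases Nat.even_or_odd (r - i) with hp | hp <;> rw [hp.neg_one_pow, hp.neg_one_pow] <;> simp

/-- The weight that the Bernstein polynomial of index `j` and degree `N` receives from the linear
functional on polynomials with moments `m`. -/
noncomputable def bernsteinWeight (m : ℕ → ℂ) (N j : ℕ) : ℂ :=
  (N.choose j : ℂ) * ((-1) ^ (N - j) * (fwdDiff 1)^[N - j] m j)

/-- The functional with moments `m`, applied to the expansion of `t ^ k` in Bernstein polynomials of
degree `N`. -/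
theorem sum_bernsteinWeight_mul_descFactorial (m : ℕ → ℂ) {k N : ℕ} (hk : k ≤ N) :
    ∑ j ∈ range (N + 1), bernsteinWeight m N j *
      ((j.descFactorial k : ℂ) / (N.descFactorial k : ℂ)) = m k := by
  obtain ⟨r, rfl⟩ := Nat.exists_eq_add_of_le hk
  have h0 : ((k + r).descFactorial k : ℂ) ≠ 0 := by
    exact_mod_cast (Nat.descFactorial_pos.2 hk).ne'
  rw [add_assoc, sum_range_add, sum_eq_zero, zero_add, eq_sum_choose_mul_fwdDiff_iter m k r]
  · refine sum_congr rfl fun i hi => ?_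
    have hi' : i ≤ r := by simpa [Nat.lt_succ_iff] using hi
    have h1 : (k + r).choose (k + i) * (k + i).choose k = (k + r).choose k * r.choose i := by
      simpa using Nat.choose_mul (n := k + r) (k := k + i) (s := k) (by omega)
    have h2 : (((k + r).choose (k + i) : ℕ) : ℂ) * ((k + i).descFactorial k : ℕ) =
        ((k + r).descFactorial k : ℕ) * (r.choose i : ℕ) := by
      rw [Nat.descFactorial_eq_factorial_mul_choose, Nat.descFactorial_eq_factorial_mul_choose]
      norm_cast
      calc _ = k.factorial * ((k + r).choose (k + i) * (k + i).choose k) := by ring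
        _ = _ := by rw [h1]; ring
    rw [bernsteinWeight, show k + r - (k + i) = r - i by omega, mul_div_assoc', div_eq_iff h0]
    linear_combination ((-1) ^ (r - i) * (fwdDiff 1)^[r - i] m (k + i)) * h2
  · intro j hj
    rw [Nat.descFactorial_of_lt (mem_range.1 hj)]
    simp

/-- Both terms are products of `k` factors in `[0, 1]`; the factors `(j - i) / (N - i)` (truncated
at `0`) and `j / N` differ by at most `i / (N - i)`. The bound is uniform in `j`. -/
theorem abs_descFactorial_div_sub_pow_le {k N j : ℕ} (hk : k ≤ N) (hN : 0 < N) (hj : j ≤ N) :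
    |(j.descFactorial k : ℝ) / N.descFactorial k - ((j : ℝ) / N) ^ k| ≤
      ∑ i ∈ range k, (i : ℝ) / ((N : ℝ) - i) := by
  induction k with
  | zero => simp
  | succ k ih =>
    have ih := ih (by omega)
    have hkN : (0 : ℝ) < (N : ℝ) - k := by
      have : (k : ℝ) + 1 ≤ N := by exact_mod_cast hk
      linarith
    have hN' : (0 : ℝ) < N := by exact_mod_cast hN
    have hj' : (j : ℝ) ≤ N := by exact_mod_cast hj
    have hx0 : 0 ≤ (j : ℝ) / N := by positivity
    have hx1 : (j : ℝ) / N ≤ 1 := (div_le_one hN').2 hj'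
    have hk0 : (0 : ℝ) ≤ k := by positivity
    set c : ℝ := (j.descFactorial k : ℝ) / N.descFactorial k with hc
    have hc0 : 0 ≤ c := by positivity
    have hc1 : c ≤ 1 := by
      refine div_le_one_of_le₀ ?_ (by positivity)
      exact_mod_cast Nat.descFactorial_le k hj
    have hstep : (j.descFactorial (k + 1) : ℝ) / N.descFactorial (k + 1) =
        c * (((j - k : ℕ) : ℝ) / ((N : ℝ) - k)) := by
      rw [Nat.descFactorial_succ, Nat.descFactorial_succ, Nat.cast_mul, Nat.cast_mul,
        Nat.cast_sub (by omega : k ≤ N), hc, div_mul_div_comm]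
      congr 1 <;> ring
    have hd : |((j - k : ℕ) : ℝ) / ((N : ℝ) - k) - (j : ℝ) / N| ≤ (k : ℝ) / ((N : ℝ) - k) := by
      rcases le_total k j with h | h
      · rw [Nat.cast_sub h, abs_sub_comm]
        have e : (j : ℝ) / N - ((j : ℝ) - k) / ((N : ℝ) - k) =
            (k / ((N : ℝ) - k)) * (1 - (j : ℝ) / N) := by
          field_simp
          ring
        rw [e, abs_of_nonneg (mul_nonneg (by positivity) (by linarith))]
        exact mul_le_of_le_one_right (by positivity) (by linarith)
      · rw [Nat.sub_eq_zero_of_le h, Nat.cast_zero, zero_div, zero_sub, abs_neg,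
          abs_of_nonneg hx0]
        have : (j : ℝ) ≤ k := by exact_mod_cast h
        gcongr
        linarith
    rw [hstep, sum_range_succ, pow_succ]
    calc _ = |c * (((j - k : ℕ) : ℝ) / ((N : ℝ) - k) - (j : ℝ) / N) +
          (c - ((j : ℝ) / N) ^ k) * ((j : ℝ) / N)| := by congr 1; ring
      _ ≤ c * |((j - k : ℕ) : ℝ) / ((N : ℝ) - k) - (j : ℝ) / N| +
          |c - ((j : ℝ) / N) ^ k| * ((j : ℝ) / N) := by
        refine (abs_add_le _ _).trans (le_of_eq ?_)
        rw [abs_mul, abs_mul, abs_of_nonneg hc0, abs_of_nonneg hx0]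
      _ ≤ 1 * ((k : ℝ) / ((N : ℝ) - k)) + (∑ i ∈ range k, (i : ℝ) / ((N : ℝ) - i)) * 1 := by
        gcongr
        exact (abs_nonneg _).trans ih
      _ = _ := by ring

theorem tendsto_sum_div_sub_atTop (k : ℕ) :
    Tendsto (fun N : ℕ => ∑ i ∈ range k, (i : ℝ) / ((N : ℝ) - i)) atTop (nhds 0) := by
  rw [← sum_const_zero (s := range k)]
  refine tendsto_finsetSum _ fun i _ => ?_
  exact tendsto_const_nhds.div_atTop
    (tendsto_atTop_add_const_right _ (-(i : ℝ)) tendsto_natCast_atTop_atTop)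

/-- The weights are nonnegative, so this is the moment identity for `k = 0`. -/
theorem sum_norm_bernsteinWeight {m : ℕ → ℂ}
    (hm : ∀ n k : ℕ, 0 ≤ (-1) ^ k * (fwdDiff 1)^[k] m n) (N : ℕ) :
    ∑ j ∈ range (N + 1), ‖bernsteinWeight m N j‖ = ‖m 0‖ := by
  have hw : ∀ j, 0 ≤ bernsteinWeight m N j := fun j => mul_nonneg (by positivity) (hm _ _)
  have h0 : 0 ≤ m 0 := by simpa using hm 0 0
  have h : ((∑ j ∈ range (N + 1), ‖bernsteinWeight m N j‖ : ℝ) : ℂ) = (‖m 0‖ : ℝ) := by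
    rw [Complex.ofReal_sum, ← Complex.eq_coe_norm_of_nonneg h0]
    rw [sum_congr rfl fun j _ => (Complex.eq_coe_norm_of_nonneg (hw j)).symm]
    simpa using sum_bernsteinWeight_mul_descFactorial m (Nat.zero_le N)
  exact_mod_cast h

/-- The inclusion of the unit interval into `ℂ`. -/
def unitIntervalToComplex : C(unitInterval, ℂ) :=
  ⟨fun t => ((t : ℝ) : ℂ), by fun_prop⟩

theorem natCast_div_mem_unitInterval {N : ℕ} (j : Fin (N + 1)) :
    ((j : ℕ) : ℝ) / N ∈ unitInterval :=
  ⟨by positivity, div_le_one_of_le₀ (by exact_mod_cast Nat.lt_succ_iff.1 j.2) (by positivity)⟩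

/-- The functional integrating against the Bernstein weights at the nodes `j / N`. -/
noncomputable def bernsteinFunctional (m : ℕ → ℂ) (N : ℕ) : C(unitInterval, ℂ) →L[ℂ] ℂ :=
  ∑ j : Fin (N + 1), bernsteinWeight m N j •
    ContinuousMap.evalCLM ℂ (⟨_, natCast_div_mem_unitInterval j⟩ : unitInterval)

theorem bernsteinFunctional_apply (m : ℕ → ℂ) (N : ℕ) (f : C(unitInterval, ℂ)) :
    bernsteinFunctional m N f = ∑ j : Fin (N + 1), bernsteinWeight m N j *
      f ⟨_, natCast_div_mem_unitInterval j⟩ := by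
  simp [bernsteinFunctional]

theorem norm_bernsteinFunctional_le {m : ℕ → ℂ}
    (hm : ∀ n k : ℕ, 0 ≤ (-1) ^ k * (fwdDiff 1)^[k] m n) (N : ℕ) :
    ‖bernsteinFunctional m N‖ ≤ ‖m 0‖ := by
  refine ContinuousLinearMap.opNorm_le_bound _ (norm_nonneg _) fun f => ?_
  rw [bernsteinFunctional_apply, ← sum_norm_bernsteinWeight hm N,
    ← Fin.sum_univ_eq_sum_range (fun j => ‖bernsteinWeight m N j‖), sum_mul]
  refine norm_sum_le_of_le _ fun j _ => ?_
  rw [norm_mul]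
  gcongr
  exact f.norm_coe_le_norm _

theorem tendsto_bernsteinFunctional_pow {m : ℕ → ℂ}
    (hm : ∀ n k : ℕ, 0 ≤ (-1) ^ k * (fwdDiff 1)^[k] m n) (k : ℕ) :
    Tendsto (fun N => bernsteinFunctional m N (unitIntervalToComplex ^ k)) atTop
      (nhds (m k)) := by
  rw [tendsto_iff_norm_sub_tendsto_zero]
  have hlim := (tendsto_sum_div_sub_atTop k).const_mul ‖m 0‖
  rw [mul_zero] at hlim
  refine squeeze_zero' (Eventually.of_forall fun _ => norm_nonneg _) ?_ hlim
  filter_upwards [eventually_ge_atTop (k + 1)] with N hN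
  have h1 : bernsteinFunctional m N (unitIntervalToComplex ^ k) =
      ∑ j ∈ range (N + 1), bernsteinWeight m N j * ((((j : ℝ) / N) ^ k : ℝ) : ℂ) := by
    rw [bernsteinFunctional_apply, ← Fin.sum_univ_eq_sum_range
      (fun j => bernsteinWeight m N j * ((((j : ℝ) / N) ^ k : ℝ) : ℂ))]
    simp [unitIntervalToComplex]
  rw [h1, norm_sub_rev, ← sum_bernsteinWeight_mul_descFactorial m (by omega : k ≤ N),
    ← sum_sub_distrib, ← sum_norm_bernsteinWeight hm N, sum_mul]
  refine norm_sum_le_of_le _ fun j hj => ?_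
  have h2 := abs_descFactorial_div_sub_pow_le (k := k) (N := N) (j := j) (by omega) (by omega)
    (Nat.lt_succ_iff.1 (mem_range.1 hj))
  rw [← mul_sub, norm_mul]
  gcongr
  rw [← Real.norm_eq_abs, ← Complex.norm_real] at h2
  simpa using h2

/-- A completely monotone sequence is the moment sequence of a bounded functional on `C[0, 1]`. -/
theorem exists_functional_of_completelyMonotone {m : ℕ → ℂ}
    (hm : ∀ n k : ℕ, 0 ≤ (-1) ^ k * (fwdDiff 1)^[k] m n) :
    ∃ L : C(unitInterval, ℂ) →L[ℂ] ℂ, ∀ k, L (unitIntervalToComplex ^ k) = m k := by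
  let F : ℕ → WeakDual ℂ C(unitInterval, ℂ) :=
    fun N => StrongDual.toWeakDual (bernsteinFunctional m N)
  -- Banach–Alaoglu: the uniformly bounded functionals converge weak-* along an ultrafilter finer
  -- than `atTop`.
  have hcomp := WeakDual.isCompact_closedBall (𝕜 := ℂ) (E := C(unitInterval, ℂ)) 0 ‖m 0‖
  obtain ⟨L, -, hL⟩ := hcomp.ultrafilter_le_nhds ((hyperfilter ℕ).map F) (by
    rw [le_principal_iff]
    refine Filter.mem_map.2 (Filter.Eventually.of_forall fun N => ?_)
    simpa [F] using norm_bernsteinFunctional_le hm N)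
  refine ⟨WeakDual.toStrongDual L, fun k => ?_⟩
  have h1 : Tendsto (fun N => F N (unitIntervalToComplex ^ k)) (hyperfilter ℕ)
      (nhds (L (unitIntervalToComplex ^ k))) :=
    ((WeakDual.eval_continuous (unitIntervalToComplex ^ k)).tendsto L).comp hL
  have h2 := (tendsto_bernsteinFunctional_pow hm k).mono_left Nat.hyperfilter_le_atTop
  exact tendsto_nhds_unique h1 h2

/-! ### Continuation of the generating function -/

/-- The values `1 + t w` fill the segment from `1` to `1 + w`, which stays in the slit plane and so
avoids `0`. -/
theorem isUnit_one_add_smul_unitIntervalToComplex {w : ℂ} (hw : 1 + w ∈ Complex.slitPlane) :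
    IsUnit (1 + w • unitIntervalToComplex) := by
  rw [ContinuousMap.isUnit_iff_forall_ne_zero]
  intro t
  have h := Complex.starConvex_one_slitPlane.add_smul_mem hw t.2.1 t.2.2
  simpa [unitIntervalToComplex, mul_comm] using Complex.slitPlane_ne_zero h

/-- The generating function of a completely monotone sequence continues analytically to the
complement of a ray. -/
theorem exists_analyticOnNhd_of_completelyMonotone {m : ℕ → ℂ}
    (hm : ∀ n k : ℕ, 0 ≤ (-1) ^ k * (fwdDiff 1)^[k] m n) :
    ∃ G : ℂ → ℂ, AnalyticOnNhd ℂ G {w | 1 + w ∈ Complex.slitPlane} ∧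
      ∀ w : ℂ, ‖w‖ < 1 → HasSum (fun k => (-w) ^ k * m k) (G w) := by
  obtain ⟨L, hL⟩ := exists_functional_of_completelyMonotone hm
  refine ⟨fun w => L (Ring.inverse (1 + w • unitIntervalToComplex)), fun w hw => ?_,
    fun w hw => ?_⟩
  · refine (L.analyticAt _).comp ?_
    refine AnalyticAt.comp (g := Ring.inverse)
      (f := fun w : ℂ => 1 + w • unitIntervalToComplex) ?_ (by fun_prop)
    obtain ⟨u, hu⟩ := isUnit_one_add_smul_unitIntervalToComplex hw
    rw [← hu]
    exact analyticAt_inverse u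
  · have hx : ‖unitIntervalToComplex‖ ≤ 1 := by
      rw [ContinuousMap.norm_le _ zero_le_one]
      intro t
      simpa [unitIntervalToComplex, abs_of_nonneg t.2.1] using t.2.2
    have hn : ‖(-w) • unitIntervalToComplex‖ < 1 := by
      rw [norm_smul, norm_neg]
      exact (mul_le_of_le_one_right (norm_nonneg _) hx).trans_lt hw
    have h := L.hasSum (hasSum_geom_series_inverse _ hn)
    rw [show 1 - (-w) • unitIntervalToComplex = 1 + w • unitIntervalToComplex by
      ext t; simp] at h
    simpa [smul_pow, hL] using h

/-! ### Logarithmic derivatives and zeros -/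

theorem differentiable_of_hasSum_pow {a : ℕ → ℂ} {h : ℂ → ℂ}
    (hsum : ∀ z, HasSum (fun n => a n * z ^ n) (h z)) : Differentiable ℂ h := by
  have hr : (FormalMultilinearSeries.ofScalars ℂ a).radius = ⊤ := by
    refine FormalMultilinearSeries.radius_eq_top_of_summable_norm _ fun r => ?_
    have := (hsum (r : ℝ)).summable.norm
    simpa [FormalMultilinearSeries.ofScalars_norm] using this
  have hp : HasFPowerSeriesOnBall h (FormalMultilinearSeries.ofScalars ℂ a) 0 ⊤ :=
    ⟨hr.ge, by simp, fun {y} _ => by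
      simpa [FormalMultilinearSeries.ofScalars_apply_eq, mul_comm] using hsum y⟩
  intro z
  exact (hp.analyticAt_of_mem (by simp)).differentiableAt

theorem hasSum_iteratedDeriv_of_analyticAt {φ : ℂ → ℂ} (hφ : AnalyticAt ℂ φ 0) :
    ∀ᶠ w in nhds (0 : ℂ),
      HasSum (fun n : ℕ => iteratedDeriv n φ 0 / n.factorial * w ^ n) (φ w) := by
  filter_upwards [hφ.hasFPowerSeriesAt.eventually_hasSum] with w hw
  simpa [FormalMultilinearSeries.ofScalars_apply_eq, mul_comm] using hw

/-- A nonzero analytic function has no zeros where its logarithmic derivative is analytic. -/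
theorem eventually_eq_zero_of_deriv_eq_mul {h g : ℂ → ℂ} {z : ℂ} (hh : AnalyticAt ℂ h z)
    (hg : AnalyticAt ℂ g z) (hz : h z = 0) (hd : deriv h =ᶠ[nhds z] h * g) :
    ∀ᶠ w in nhds z, h w = 0 := by
  rw [← analyticOrderAt_eq_top]
  -- At a zero, `ord h = ord h' + 1`, while `h' = h * g` gives `ord h' ≥ ord h`; so the order is
  -- infinite.
  have h1 := hh.analyticOrderAt_deriv_add_one
  simp only [hz, sub_zero] at h1
  rw [analyticOrderAt_congr hd, analyticOrderAt_mul hh hg] at h1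
  by_contra htop
  obtain ⟨n, hn⟩ := ENat.ne_top_iff_exists.1 htop
  rw [← hn] at h1
  have h2 : (n : ℕ∞) + 1 ≤ n := by
    calc (n : ℕ∞) + 1 ≤ n + analyticOrderAt g z + 1 := by gcongr; exact le_self_add
      _ = n := h1
  have h3 : n + 1 ≤ n := by exact_mod_cast h2
  omega

/-- An entire function whose logarithmic derivative has completely monotone moments is zero-free
off the ray `(-∞, -1]`. -/
theorem ne_zero_of_completelyMonotone {h : ℂ → ℂ} (hh : Differentiable ℂ h) (h0 : h 0 ≠ 0)
    (hmom : ∀ n k : ℕ, 0 ≤ (-1) ^ k * (fwdDiff 1)^[k] (logDerivMoment h) n) {z : ℂ}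
    (hz : 1 + z ∈ Complex.slitPlane) : h z ≠ 0 := by
  obtain ⟨G, hG, hGsum⟩ := exists_analyticOnNhd_of_completelyMonotone hmom
  have hhan : ∀ w, AnalyticAt ℂ h w := hh.analyticAt
  set U : Set ℂ := {w | 1 + w ∈ Complex.slitPlane} with hU
  have hUo : IsOpen U := Complex.isOpen_slitPlane.preimage (by fun_prop)
  have h0U : (0 : ℂ) ∈ U := by simp [hU]
  have hUc : IsPreconnected U := by
    have hs : StarConvex ℝ (0 : ℂ) U := by
      rw [starConvex_zero_iff]
      intro w hw t ht0 ht1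
      exact Complex.starConvex_one_slitPlane.add_smul_mem hw ht0 ht1
    exact (hs.isPathConnected h0U).isConnected.isPreconnected
  set c := logDeriv h 0
  have hg : AnalyticOnNhd ℂ (fun w => c - w * G w) U := fun w hw =>
    analyticAt_const.sub (analyticAt_id.mul (hG w hw))
  have hlog : AnalyticAt ℂ (logDeriv h) 0 := (hhan 0).deriv.div (hhan 0) h0
  -- Clearing the denominator `h` keeps the identity analytic on all of `U`, even at possible zeros
  -- of `h`.
  have hnear : (fun w => deriv h w - h w * (c - w * G w)) =ᶠ[nhds 0] 0 := by
    filter_upwards [hasSum_iteratedDeriv_of_analyticAt hlog,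
      Metric.ball_mem_nhds (0 : ℂ) one_pos, (hhan 0).continuousAt.eventually_ne h0]
      with w hw1 hw2 hw3
    have hs := (hGsum w (by simpa using hw2)).mul_left (-w)
    have hs' : HasSum (fun k : ℕ => iteratedDeriv (k + 1) (logDeriv h) 0 /
        (k + 1).factorial * w ^ (k + 1)) (-w * G w) := by
      refine (congrArg (HasSum · _) (funext fun k => ?_)).mpr hs
      have hsq : ((-1 : ℂ) ^ k) * (-1) ^ k = 1 := by rw [← mul_pow]; simp
      rw [logDerivMoment, neg_pow w k]
      linear_combination (-(w ^ (k + 1) * iteratedDeriv (k + 1) (logDeriv h) 0 /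
        (k + 1).factorial)) * hsq
    have he := ((hasSum_nat_add_iff' 1).2 hw1).unique hs'
    have he' : logDeriv h w = c - w * G w := by
      simp only [sum_range_one, iteratedDeriv_zero, Nat.factorial_zero, Nat.cast_one, div_one,
        pow_zero, mul_one] at he
      linear_combination he
    rw [logDeriv_apply] at he'
    simp only [Pi.zero_apply]
    rw [← he']
    field_simp
    ring
  have hP : AnalyticOnNhd ℂ (fun w => deriv h w - h w * (c - w * G w)) U := fun w hw =>
    (hhan w).deriv.sub ((hhan w).mul (hg w hw))
  have hzero := hP.eqOn_zero_of_preconnected_of_eventuallyEq_zero hUc h0U hnear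
  intro hz0
  have hloc := eventually_eq_zero_of_deriv_eq_mul (hhan z) (hg z hz) hz0 (by
    filter_upwards [hUo.mem_nhds hz] with w hw
    exact sub_eq_zero.1 (hzero hw))
  have hall := AnalyticOnNhd.eqOn_zero_of_preconnected_of_eventuallyEq_zero
    (fun w _ => hhan w) isPreconnected_univ (Set.mem_univ z) hloc
  exact h0 (hall (Set.mem_univ 0))

/-- `h` is the entire function `z ^ (-μ) * f z`, with its removable singularity at `0` removed. -/
theorem corollary3
    (f h : ℂ → ℂ) (μ : ℕ) (a : ℕ → ℝ) (β₀ γ₀ : ℝ)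
    (hf : Differentiable ℂ f)
    (hord : entireOrder f < 1)
    (hfh : ∀ z, f z = z ^ μ * h z)
    (hsum : ∀ z, HasSum (fun n : ℕ => (a n : ℂ) * z ^ n) (h z))
    (ha : ∀ n : ℕ, 1 ≤ n → 0 < a 0 * a n)
    (hβ₀ : 0 < β₀) (hβ₁ : β₀ < 1)
    (hdom : ∀ w ∈ negNonzeroRoots f, β₀ * ‖w‖ ≤ w.re)
    (hγ : IsGLB (Complex.re '' negNonzeroRoots f) γ₀) (hγ₁ : 1 < γ₀)
    (hmom : ∀ n k : ℕ, 0 ≤ (-1) ^ k * (fwdDiff 1)^[k] (logDerivMoment h) n) :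
    ∀ z : ℂ, f z = 0 → (z = 0 ∧ μ ≠ 0) ∨ (z.im = 0 ∧ z.re < 0) := by
  have h0 : h 0 ≠ 0 := by
    have hs := hasSum_single (f := fun n : ℕ => (a n : ℂ) * (0 : ℂ) ^ n) 0
      fun n hn => by simp [hn]
    rw [(hsum 0).unique hs]
    simpa using left_ne_zero_of_mul (ha 1 le_rfl).ne'
  intro z hz
  rw [hfh, mul_eq_zero] at hz
  rcases hz with hz | hz
  · exact Or.inl ⟨eq_zero_of_pow_eq_zero hz, fun hμ => by simp [hμ] at hz⟩
  · right
    -- Outside the slit plane, `1 + z` is real and at most `0`, so `z ≤ -1`.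
    have hslit : 1 + z ∉ Complex.slitPlane := fun hmem =>
      ne_zero_of_completelyMonotone (differentiable_of_hasSum_pow hsum) h0 hmom hmem hz
    simp only [Complex.mem_slitPlane_iff, not_or, not_lt, not_not, Complex.add_re,
      Complex.add_im, Complex.one_re, Complex.one_im, zero_add] at hslit
    exact ⟨hslit.2, by linarith [hslit.1]⟩
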